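/- Let $G$ be a subgroup of $\mathbb{Q}^d$, let $R$ be a commutative Noetherian $G$-graded ring and let $M$ be a finitely generated $G$-graded $R$-module that is modest, i.e. the length $\ell_{R_0}(M_g)$ is finite for every $g \in G$. Let $\mathbb{Z}[\mathbb{Q}^d]$ be the ring of finite sums $\sum_{t \in \mathbb{Q}^d} a_t z^t$ with $a_t \in \mathbb{Z}$ (Laurent polynomials with rational exponents, $z^t = z_1^{t_1}\cdots z_d^{t_d}$), let $\mathbb{Z}[[\mathbb{Q}^d]]$ be the $\mathbb{Z}[\mathbb{Q}^d]$-module of formal, possibly infinite sums of the same shape, and let $HS_M(z) = \sum_{t \in G} \ell_{R_0}(M_t) z^t \in \mathbb{Z}[[\mathbb{Q}^d]]$ be the Hilbert series of $M$. Then there exist finitely many nonzero elements $v_1, \dots, v_s \in G$ ($s \ge 0$) such that $$HS_M(z) \prod_{i=1}^{s} (1 - z^{v_i}) \in \mathbb{Z}[\mathbb{Q}^d].$$ Moreover, $HS_M(z)$ is summable: there is a nonzero $b(z) \in \mathbb{Z}[z_1^{\pm 1}, \dots, z_d^{\pm 1}]$ such that $b(z)\,HS_M(z) \in \mathbb{Z}[\mathbb{Q}^d]$.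 -/

import Mathlib

noncomputable section

namespace GradedHilbert

/-- `ℤ[ℚ^d]`: finite sums `∑ a_t z^t` with exponents `t ∈ ℚ^d`
(Laurent polynomials with rational exponents). -/
abbrev RatLaurent (d : ℕ) : Type := AddMonoidAlgebra ℤ (Fin d → ℚ)

/-- `ℤ[[ℚ^d]]`: formal, possibly infinite sums `∑ a_t z^t`, `t ∈ ℚ^d`, given by their
coefficients. -/
abbrev FormalSeries (d : ℕ) : Type := (Fin d → ℚ) → ℤ

/-- The product `p(z) a(z)` of a finite sum `p = ∑ p_u z^u` and a formal series `a`: the coefficient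
at `t` is `∑_u p_u a_{t-u}`. -/
def polyMul {d : ℕ} (p : RatLaurent d) (a : FormalSeries d) : FormalSeries d :=
  fun t => ∑ u ∈ p.coeff.support, p.coeff u * a (t - u)

/-- The formal series `a` is a finite sum, that is, it lies in `ℤ[ℚ^d]`. -/
def IsRatLaurent {d : ℕ} (a : FormalSeries d) : Prop :=
  ∃ c : RatLaurent d, ∀ t, a t = c.coeff t

/-- The subset `ℤ[z, z⁻¹] = ℤ[z_1^{±1}, …, z_d^{±1}]` of `ℤ[ℚ^d]`: all exponents are integral. -/
def IsIntegralLaurent {d : ℕ} (b : RatLaurent d) : Prop :=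
  ∀ t ∈ b.coeff.support, ∀ i, ∃ n : ℤ, t i = (n : ℚ)

/-- A formal series is summable if some nonzero `b ∈ ℤ[z, z⁻¹]` multiplies it into `ℤ[ℚ^d]`. -/
def IsSummable {d : ℕ} (a : FormalSeries d) : Prop :=
  ∃ b : RatLaurent d, b ≠ 0 ∧ IsIntegralLaurent b ∧ IsRatLaurent (polyMul b a)

section Graded

variable {d : ℕ} {G : AddSubgroup (Fin d → ℚ)} {R M : Type*} [CommRing R] [AddCommGroup M]
  [Module R M] (𝒜 : G → AddSubgroup R) [GradedRing 𝒜]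
  (ℳ : G → AddSubgroup M) [SetLike.GradedSMul 𝒜 ℳ]

/-- The homogeneous component `M_g`, as a module over the subring `R_0` of `R`. -/
def component (g : G) : Submodule (SetLike.GradeZero.subring 𝒜) M where
  carrier := ℳ g
  add_mem' := fun ha hb => (ℳ g).add_mem ha hb
  zero_mem' := (ℳ g).zero_mem
  smul_mem' := fun r m hm => by
    have h := SetLike.GradedSMul.smul_mem (A := 𝒜) (B := ℳ) (i := 0) (j := g)
      (ai := (r : R)) (bj := m) r.2 hm
    rw [zero_vadd] at h
    exact h

/-- `M` is modest: every `M_g` has finite length over `R_0`. -/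
def IsModest : Prop :=
  ∀ g : G, Module.length (SetLike.GradeZero.subring 𝒜) (component 𝒜 ℳ g) < ⊤

open Classical in
/-- The Hilbert series `∑ ℓ_{R_0}(M_t) z^t`; the coefficient at `t ∉ G` is zero. It is meaningful
when `M` is modest, so that all the lengths are finite. -/
def hilbertSeries : FormalSeries d := fun t =>
  if h : t ∈ G then
    ((Module.length (SetLike.GradeZero.subring 𝒜) (component 𝒜 ℳ ⟨t, h⟩)).toNat : ℤ)
  else 0

end Graded

end GradedHilbert

end

/-!
For a homogeneous submodule `N` of `M` let `h_N(t)` be the length of `N_t = N ∩ M_t`, so that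
`h_{N'} - h_N` is the Hilbert series of `N' / N` for `N ≤ N'`. Call a formal series rational if
a product of factors `1 - z^v`, `0 ≠ v ∈ G`, multiplies it into `ℤ[ℚ^d]`. Sums of rational series
are rational, and so is `a` as soon as `(1 - z^v) a` is.

By Noetherian induction on `N`, `h_M - h_N` is rational for every homogeneous `N`
(`isRational_hilbertFun_top_sub`). For `N ≠ M` pick a homogeneous `m ∉ N` whose annihilator
`(N : m)` modulo `N` is maximal, and put `N' = N + Rm`. The induction hypothesis applies to `N'`,
so it remains to treat `N' / N`.
* If some homogeneous `x` of degree `v ≠ 0` has `xm ∉ N`, then `(N : xm) = (N : m)` by maximality,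
  so multiplication by `x` embeds `N' / N` into itself with image `N'' / N`, `N'' = N + Rxm`. Thus
  `z^v (h_{N'} - h_N) = h_{N''} - h_N`, that is
  `(1 - z^v) (h_{N'} - h_N) = (h_M - h_{N''}) - (h_M - h_{N'})`, which is rational by the induction
  hypothesis for `N'` and `N''`.
* Otherwise every homogeneous element of nonzero degree maps `m` into `N`, so `N' / N` lives in the
  single degree of `m` and `h_{N'} - h_N` has at most one nonzero coefficient.

In this way neither a finite set of algebra generators of `R` over `R_0` nor a prime filtration of
`M` is needed. The case `N = 0` is the first claim. Summability follows since `1 - z^v` divides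
`1 - z^{nv}`, which has integral exponents for a suitable `n > 0`.
-/

noncomputable section

namespace GradedHilbert

open DirectSum

/-! ### The action of `ℤ[ℚ^d]` on formal series -/

section Series

variable {d : ℕ}

lemma polyMul_apply (p : RatLaurent d) (a : FormalSeries d) (t : Fin d → ℚ) :
    polyMul p a t = p.coeff.sum fun u c => c * a (t - u) := rfl

lemma polyMul_add_left (p q : RatLaurent d) (a : FormalSeries d) :
    polyMul (p + q) a = polyMul p a + polyMul q a := by
  ext t
  simp only [polyMul_apply, Pi.add_apply, AddMonoidAlgebra.coeff_add]
  exact Finsupp.sum_add_index' (by simp) (by intros; ring)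

lemma polyMul_single (u : Fin d → ℚ) (c : ℤ) (a : FormalSeries d) (t : Fin d → ℚ) :
    polyMul (AddMonoidAlgebra.single u c) a t = c * a (t - u) := by
  rw [polyMul_apply, AddMonoidAlgebra.coeff_single, Finsupp.sum_single_index (by simp)]

lemma polyMul_zero_left (a : FormalSeries d) : polyMul 0 a = 0 := by
  ext t
  simp [polyMul_apply]

lemma polyMul_one_sub_single (v : Fin d → ℚ) (a : FormalSeries d) (t : Fin d → ℚ) :
    polyMul (1 - AddMonoidAlgebra.single v 1) a t = a t - a (t - v) := by
  have h : (1 - AddMonoidAlgebra.single v 1 : RatLaurent d)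
      = AddMonoidAlgebra.single 0 1 + AddMonoidAlgebra.single v (-1) := by
    rw [AddMonoidAlgebra.single_neg, ← AddMonoidAlgebra.one_def, sub_eq_add_neg]
  rw [h, polyMul_add_left, Pi.add_apply, polyMul_single, polyMul_single, sub_zero]
  ring

lemma polyMul_add_right (p : RatLaurent d) (a b : FormalSeries d) :
    polyMul p (a + b) = polyMul p a + polyMul p b := by
  ext t
  simp only [polyMul, Pi.add_apply, mul_add, Finset.sum_add_distrib]

lemma polyMul_neg_right (p : RatLaurent d) (a : FormalSeries d) :
    polyMul p (-a) = -polyMul p a := by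
  ext t
  simp only [polyMul, Pi.neg_apply, mul_neg, Finset.sum_neg_distrib]

lemma polyMul_mul (p q : RatLaurent d) (a : FormalSeries d) :
    polyMul (p * q) a = polyMul p (polyMul q a) := by
  induction p using AddMonoidAlgebra.induction_linear with
  | zero => simp [polyMul_zero_left]
  | add p p' hp hp' => rw [add_mul, polyMul_add_left, polyMul_add_left, hp, hp']
  | single u c =>
    induction q using AddMonoidAlgebra.induction_linear with
    | zero =>
      ext t
      simp [polyMul_zero_left, polyMul_single]
    | add q q' hq hq' =>
      rw [mul_add, polyMul_add_left, polyMul_add_left, polyMul_add_right, hq, hq']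
    | single w e =>
      ext t
      rw [AddMonoidAlgebra.single_mul_single]
      simp only [polyMul_single]
      rw [mul_assoc, sub_sub]

lemma isRatLaurent_iff {a : FormalSeries d} :
    IsRatLaurent a ↔ (Function.support a).Finite := by
  constructor
  · rintro ⟨c, hc⟩
    rw [show a = c.coeff from funext hc]
    exact c.coeff.hasFiniteSupport
  · intro h
    exact ⟨.ofCoeff (Finsupp.ofSupportFinite a h), fun t => rfl⟩

lemma IsRatLaurent.add {a b : FormalSeries d} (ha : IsRatLaurent a) (hb : IsRatLaurent b) :
    IsRatLaurent (a + b) := by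
  rw [isRatLaurent_iff] at *
  exact (ha.union hb).subset (Function.support_add a b)

lemma IsRatLaurent.neg {a : FormalSeries d} (ha : IsRatLaurent a) : IsRatLaurent (-a) := by
  rw [isRatLaurent_iff] at *
  rwa [Function.support_neg]

lemma IsRatLaurent.polyMul (p : RatLaurent d) {a : FormalSeries d} (ha : IsRatLaurent a) :
    IsRatLaurent (polyMul p a) := by
  induction p using AddMonoidAlgebra.induction_linear with
  | zero =>
    rw [polyMul_zero_left, isRatLaurent_iff]
    simp
  | add p p' hp hp' =>
    rw [polyMul_add_left]
    exact hp.add hp'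
  | single u c =>
    rw [isRatLaurent_iff] at ha ⊢
    refine (ha.preimage (sub_left_injective (b := u)).injOn).subset fun t ht => ?_
    rw [Function.mem_support, polyMul_single] at ht
    exact right_ne_zero_of_mul ht

/-- The product of the factors `1 - z^v`, `v` running through the list `l`. -/
def oneSubProd (l : List (Fin d → ℚ)) : RatLaurent d :=
  (l.map fun v => 1 - AddMonoidAlgebra.single v 1).prod

lemma oneSubProd_cons (v : Fin d → ℚ) (l : List (Fin d → ℚ)) :
    oneSubProd (v :: l) = (1 - AddMonoidAlgebra.single v 1) * oneSubProd l := by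
  simp [oneSubProd]

lemma oneSubProd_append (l l' : List (Fin d → ℚ)) :
    oneSubProd (l ++ l') = oneSubProd l * oneSubProd l' := by
  simp [oneSubProd]

/-- A formal series is rational over `G` if a finite product of factors `1 - z^v` with
`0 ≠ v ∈ G` multiplies it into `ℤ[ℚ^d]`. -/
def IsRational (G : AddSubgroup (Fin d → ℚ)) (a : FormalSeries d) : Prop :=
  ∃ l : List (Fin d → ℚ), (∀ v ∈ l, v ∈ G ∧ v ≠ 0) ∧ IsRatLaurent (polyMul (oneSubProd l) a)

variable {G : AddSubgroup (Fin d → ℚ)}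

lemma IsRatLaurent.isRational {a : FormalSeries d} (ha : IsRatLaurent a) : IsRational G a :=
  ⟨[], by simp, ha.polyMul _⟩

lemma IsRational.add {a b : FormalSeries d} (ha : IsRational G a) (hb : IsRational G b) :
    IsRational G (a + b) := by
  obtain ⟨l, hl, ha⟩ := ha
  obtain ⟨l', hl', hb⟩ := hb
  refine ⟨l ++ l', fun v hv => (List.mem_append.1 hv).elim (hl v) (hl' v), ?_⟩
  rw [oneSubProd_append, polyMul_add_right]
  refine IsRatLaurent.add ?_ ?_
  · rw [mul_comm, polyMul_mul]
    exact ha.polyMul _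
  · rw [polyMul_mul]
    exact hb.polyMul _

lemma IsRational.neg {a : FormalSeries d} (ha : IsRational G a) : IsRational G (-a) := by
  obtain ⟨l, hl, ha⟩ := ha
  refine ⟨l, hl, ?_⟩
  rw [polyMul_neg_right]
  exact ha.neg

lemma IsRational.of_polyMul {v : Fin d → ℚ} (hv : v ∈ G) (hv0 : v ≠ 0) {a : FormalSeries d}
    (h : IsRational G (polyMul (1 - AddMonoidAlgebra.single v 1) a)) : IsRational G a := by
  obtain ⟨l, hl, h⟩ := h
  refine ⟨v :: l, by simpa using ⟨⟨hv, hv0⟩, hl⟩, ?_⟩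
  rwa [oneSubProd_cons, mul_comm, polyMul_mul]

/-! ### Clearing denominators in the exponents -/

lemma IsIntegralLaurent.mul {b c : RatLaurent d} (hb : IsIntegralLaurent b)
    (hc : IsIntegralLaurent c) : IsIntegralLaurent (b * c) := by
  classical
  intro t ht i
  obtain ⟨u, hu, w, hw, rfl⟩ := Finset.mem_add.1 (AddMonoidAlgebra.support_coeff_mul_subset b c ht)
  obtain ⟨m, hm⟩ := hb u hu i
  obtain ⟨n, hn⟩ := hc w hw i
  exact ⟨m + n, by simp [hm, hn]⟩

lemma exists_pos_nsmul_integral (v : Fin d → ℚ) :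
    ∃ n : ℕ, 0 < n ∧ ∀ i, ∃ k : ℤ, (n • v) i = k := by
  refine ⟨∏ i, (v i).den, Finset.prod_pos fun i _ => (v i).den_pos, fun i => ?_⟩
  obtain ⟨k, hk⟩ := Finset.dvd_prod_of_mem (fun j => (v j).den) (Finset.mem_univ i)
  refine ⟨k * (v i).num, ?_⟩
  rw [Pi.smul_apply, hk, nsmul_eq_mul]
  push_cast
  rw [← Rat.den_mul_eq_num (v i)]
  ring

lemma isIntegralLaurent_one_sub_single {w : Fin d → ℚ} (hw : ∀ i, ∃ k : ℤ, w i = k) :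
    IsIntegralLaurent (1 - AddMonoidAlgebra.single w 1) := by
  classical
  intro t ht i
  by_cases h0 : t = 0
  · exact ⟨0, by simp [h0]⟩
  by_cases h1 : t = w
  · rw [h1]
    exact hw i
  · rw [Finsupp.mem_support_iff, AddMonoidAlgebra.coeff_sub, Finsupp.sub_apply,
      AddMonoidAlgebra.one_def, AddMonoidAlgebra.coeff_single, AddMonoidAlgebra.coeff_single,
      Finsupp.single_apply, Finsupp.single_apply] at ht
    simp [Ne.symm h0, Ne.symm h1] at ht

lemma one_sub_single_ne_zero {w : Fin d → ℚ} (hw : w ≠ 0) :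
    (1 - AddMonoidAlgebra.single w 1 : RatLaurent d) ≠ 0 := by
  rw [sub_ne_zero, AddMonoidAlgebra.one_def]
  exact fun h => hw ((AddMonoidAlgebra.single_left_inj one_ne_zero).1 h).symm

/-- A product of factors `1 - z^v` divides a nonzero Laurent polynomial with integral exponents,
namely the product of the `1 - z^{nv}` with `nv` integral. -/
lemma exists_integral_multiple {l : List (Fin d → ℚ)} (hl : ∀ v ∈ l, v ≠ 0) :
    ∃ q b : RatLaurent d, b = q * oneSubProd l ∧ b ≠ 0 ∧ IsIntegralLaurent b := by
  induction l with
  | nil =>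
    refine ⟨1, 1, by simp [oneSubProd], one_ne_zero, fun t ht i => ⟨0, ?_⟩⟩
    rw [AddMonoidAlgebra.one_def, AddMonoidAlgebra.coeff_single] at ht
    simp [Finset.mem_singleton.1 (Finsupp.support_single_subset ht)]
  | cons v l ih =>
    obtain ⟨q, b, hb, hb0, hbi⟩ := ih fun w hw => hl w (List.mem_cons_of_mem _ hw)
    obtain ⟨n, hn, hni⟩ := exists_pos_nsmul_integral v
    obtain ⟨c, hc⟩ : (1 - AddMonoidAlgebra.single v 1 : RatLaurent d) ∣
        1 - AddMonoidAlgebra.single (n • v) 1 := by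
      simpa [AddMonoidAlgebra.single_pow] using
        sub_dvd_pow_sub_pow (1 : RatLaurent d) (AddMonoidAlgebra.single v 1) n
    refine ⟨c * q, (1 - AddMonoidAlgebra.single (n • v) 1) * b, ?_, mul_ne_zero ?_ hb0,
      (isIntegralLaurent_one_sub_single hni).mul hbi⟩
    · rw [hc, hb, oneSubProd_cons]
      ring
    · exact one_sub_single_ne_zero (smul_ne_zero hn.ne' (hl v List.mem_cons_self))

lemma IsRational.isSummable {a : FormalSeries d} (ha : IsRational G a) : IsSummable a := by
  obtain ⟨l, hl, ha⟩ := ha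
  obtain ⟨q, b, hb, hb0, hbi⟩ := exists_integral_multiple fun v hv => (hl v hv).2
  refine ⟨b, hb0, hbi, ?_⟩
  rw [hb, polyMul_mul]
  exact ha.polyMul q

end Series

/-! ### Lengths of subquotients -/

/-- If a linear map `f` induces an isomorphism `N₁' / N₁ ≃ N₂' / N₂`, then these two quotients have
the same length; the equality is stated without subtraction. -/
lemma length_add_length_eq {S V : Type*} [CommRing S] [AddCommGroup V] [Module S V]
    {N₁ N₁' N₂ N₂' : Submodule S V} (h₁ : N₁ ≤ N₁') (h₂ : N₂ ≤ N₂') (f : V →ₗ[S] V)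
    (hf : ∀ y ∈ N₁', f y ∈ N₂') (hker : ∀ y ∈ N₁', f y ∈ N₂ ↔ y ∈ N₁)
    (hsurj : ∀ z ∈ N₂', ∃ y ∈ N₁', z - f y ∈ N₂) :
    Module.length S N₁' + Module.length S N₂ = Module.length S N₁ + Module.length S N₂' := by
  let π : N₂' →ₗ[S] N₂' ⧸ N₂.comap N₂'.subtype := (N₂.comap N₂'.subtype).mkQ
  let g : N₁' →ₗ[S] N₂' ⧸ N₂.comap N₂'.subtype := π ∘ₗ f.restrict hf
  have hg : ∀ y : N₁', g y = 0 ↔ (y : V) ∈ N₁ := fun y => by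
    rw [← hker y y.2]
    simp [g, π, LinearMap.restrict_apply]
  have e₁ := Module.length_eq_add_of_exact (Submodule.inclusion h₁) g
    (Submodule.inclusion_injective h₁)
    (by
      intro q
      obtain ⟨z, rfl⟩ := Submodule.mkQ_surjective _ q
      obtain ⟨y, hy, hz⟩ := hsurj z z.2
      refine ⟨⟨y, hy⟩, ?_⟩
      rw [← sub_eq_zero, ← neg_eq_zero, neg_sub]
      change π z - π _ = 0
      rw [← map_sub]
      exact (Submodule.Quotient.mk_eq_zero _).2 hz)
    (by
      intro y
      rw [hg]
      exact ⟨fun h => ⟨⟨y, h⟩, rfl⟩, by rintro ⟨x, rfl⟩; exact x.2⟩)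
  have e₂ := Module.length_eq_add_of_exact (Submodule.inclusion h₂) π
    (Submodule.inclusion_injective h₂) (Submodule.mkQ_surjective _)
    (by
      intro y
      rw [show π y = 0 ↔ (y : V) ∈ N₂ by simp [π]]
      exact ⟨fun h => ⟨⟨y, h⟩, rfl⟩, by rintro ⟨x, rfl⟩; exact x.2⟩)
  rw [e₁, e₂]
  abel

/-! ### Homogeneous submodules and their Hilbert functions -/

section Graded

variable {d : ℕ} {G : AddSubgroup (Fin d → ℚ)} {R M : Type*} [CommRing R] [AddCommGroup M]
  [Module R M] (𝒜 : G → AddSubgroup R) [GradedRing 𝒜]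
  (ℳ : G → AddSubgroup M) [SetLike.GradedSMul 𝒜 ℳ]

/-- The homogeneous component `N_g = N ∩ M_g` of a submodule `N` of `M`, over `R_0`. -/
def subComponent (N : Submodule R M) (g : G) : Submodule (SetLike.GradeZero.subring 𝒜) M :=
  component 𝒜 ℳ g ⊓ N.restrictScalars _

open Classical in
/-- The Hilbert series `∑ ℓ_{R_0}(N ∩ M_t) z^t` of a submodule `N` of `M`; as in
`hilbertSeries`, infinite lengths count as `0`, so that it is meaningful when `M` is modest. -/
def hilbertFun (N : Submodule R M) : FormalSeries d := fun t =>
  if h : t ∈ G then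
    ((Module.length (SetLike.GradeZero.subring 𝒜) (subComponent 𝒜 ℳ N ⟨t, h⟩)).toNat : ℤ)
  else 0

lemma hilbertFun_coe (N : Submodule R M) (g : G) :
    hilbertFun 𝒜 ℳ N g =
      ((Module.length (SetLike.GradeZero.subring 𝒜) (subComponent 𝒜 ℳ N g)).toNat : ℤ) :=
  dif_pos g.2

lemma hilbertFun_top : hilbertFun 𝒜 ℳ ⊤ = hilbertSeries 𝒜 ℳ := by
  have h : ∀ g, subComponent 𝒜 ℳ ⊤ g = component 𝒜 ℳ g := fun g => by
    ext y
    exact ⟨fun h => h.1, fun h => ⟨h, trivial⟩⟩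
  ext t
  by_cases ht : t ∈ G
  · simp only [hilbertFun, hilbertSeries, dif_pos ht]
    rw [h]
  · simp only [hilbertFun, hilbertSeries, dif_neg ht]

lemma hilbertFun_bot : hilbertFun 𝒜 ℳ ⊥ = 0 := by
  have h : ∀ g, subComponent 𝒜 ℳ ⊥ g = ⊥ := fun g => by
    ext y
    exact ⟨fun h => h.2, fun h => by rw [(Submodule.mem_bot _).1 h]; exact zero_mem _⟩
  ext t
  by_cases ht : t ∈ G
  · rw [hilbertFun, dif_pos ht, h, Module.length_bot]
    rfl
  · rw [hilbertFun, dif_neg ht, Pi.zero_apply]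

lemma subComponent_mono {N N' : Submodule R M} (h : N ≤ N') (g : G) :
    subComponent 𝒜 ℳ N g ≤ subComponent 𝒜 ℳ N' g := fun _ hy => ⟨hy.1, h hy.2⟩

variable {𝒜 ℳ} in
lemma IsModest.length_subComponent_ne_top (hM : IsModest 𝒜 ℳ) (N : Submodule R M) (g : G) :
    Module.length (SetLike.GradeZero.subring 𝒜) (subComponent 𝒜 ℳ N g) ≠ ⊤ :=
  ((Module.length_le_of_injective _
    (Submodule.inclusion_injective (inf_le_left : subComponent 𝒜 ℳ N g ≤ _))).trans_lt (hM g)).ne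

variable {𝒜 ℳ} in
/-- If multiplication by `x ∈ R_v` induces an isomorphism of `N' / N` with `N'' / N`, degree by
degree, then the Hilbert series of `N'' / N` is `z^v` times that of `N' / N`. -/
lemma hilbertFun_sub_shift (hM : IsModest 𝒜 ℳ) {N N' N'' : Submodule R M} (h' : N ≤ N')
    (h'' : N ≤ N'') {v : G} {x : R} (hx : x ∈ 𝒜 v) (hmap : ∀ y ∈ N', x • y ∈ N'')
    (hker : ∀ y ∈ N', x • y ∈ N ↔ y ∈ N)
    (hsurj : ∀ g, ∀ z ∈ N'', z ∈ ℳ (v + g) → ∃ y ∈ N', y ∈ ℳ g ∧ z - x • y ∈ N)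
    (t : Fin d → ℚ) :
    hilbertFun 𝒜 ℳ N' (t - v) - hilbertFun 𝒜 ℳ N (t - v) =
      hilbertFun 𝒜 ℳ N'' t - hilbertFun 𝒜 ℳ N t := by
  by_cases ht : t ∈ G
  swap
  · have ht' : t - v ∉ G := fun h => ht (by simpa using add_mem h v.2)
    simp [hilbertFun, ht, ht']
  obtain ⟨g, rfl⟩ : ∃ g : G, t = ((v + g : G) : Fin d → ℚ) :=
    ⟨⟨t, ht⟩ - v, by simp⟩
  have hs : ((v + g : G) : Fin d → ℚ) - v = g := by simp
  have hdeg : ∀ y ∈ ℳ g, x • y ∈ ℳ (v + g) := fun y hy =>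
    SetLike.GradedSMul.smul_mem (A := 𝒜) (B := ℳ) hx hy
  have key := length_add_length_eq (subComponent_mono 𝒜 ℳ h' g)
    (subComponent_mono 𝒜 ℳ h'' (v + g))
    ((LinearMap.lsmul R M x).restrictScalars (SetLike.GradeZero.subring 𝒜))
    (fun y hy => ⟨hdeg y hy.1, hmap y hy.2⟩)
    (fun y hy => ⟨fun h => ⟨hy.1, (hker y hy.2).1 h.2⟩, fun h => ⟨hdeg y hy.1, (hker y hy.2).2 h.2⟩⟩)
    (fun z hz => by
      obtain ⟨y, hy, hyg, hzy⟩ := hsurj g z hz.2 hz.1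
      exact ⟨y, ⟨hyg, hy⟩, sub_mem (show z ∈ ℳ (v + g) from hz.1) (hdeg y hyg), hzy⟩)
  have key' := congrArg ENat.toNat key
  rw [ENat.toNat_add (hM.length_subComponent_ne_top _ _) (hM.length_subComponent_ne_top _ _),
    ENat.toNat_add (hM.length_subComponent_ne_top _ _) (hM.length_subComponent_ne_top _ _)] at key'
  rw [hs]
  simp only [hilbertFun_coe]
  lia

variable [Decomposition ℳ]

variable {𝒜 ℳ} in
/-- The homogeneous components of `r • m`, for `m` homogeneous, are multiples of `m` by homogeneous
elements of the expected degrees. -/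
lemma exists_decompose_smul_eq {g : G} {m : M} (hm : m ∈ ℳ g) (r : R) (t : G) :
    ∃ r' ∈ 𝒜 (t - g), (decompose ℳ (r • m) t : M) = r' • m := by
  induction r using DirectSum.Decomposition.inductionOn 𝒜 with
  | zero => exact ⟨0, zero_mem _, by simp⟩
  | @homogeneous i r =>
    have hrm : (r : R) • m ∈ ℳ (i + g) := SetLike.GradedSMul.smul_mem r.2 hm
    by_cases h : i + g = t
    · subst h
      exact ⟨r, by simp, decompose_of_mem_same ℳ hrm⟩
    · exact ⟨0, zero_mem _, by rw [decompose_of_mem_ne ℳ hrm h, zero_smul]⟩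
  | add a b ha hb =>
    obtain ⟨a', ha', ea⟩ := ha
    obtain ⟨b', hb', eb⟩ := hb
    refine ⟨a' + b', add_mem ha' hb', ?_⟩
    rw [add_smul, decompose_add, DirectSum.add_apply, AddSubgroup.coe_add, ea, eb, add_smul]

variable {𝒜 ℳ} in
lemma exists_decompose_sub_mem {N : Submodule R M} (hN : N.IsHomogeneous ℳ) {g : G} {m : M}
    (hm : m ∈ ℳ g) {y : M} (hy : y ∈ N ⊔ R ∙ m) (t : G) :
    ∃ r ∈ 𝒜 (t - g), (decompose ℳ y t : M) - r • m ∈ N := by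
  obtain ⟨n, hn, z, hz, rfl⟩ := Submodule.mem_sup.1 hy
  obtain ⟨a, rfl⟩ := Submodule.mem_span_singleton.1 hz
  obtain ⟨r, hr, e⟩ := exists_decompose_smul_eq (𝒜 := 𝒜) hm a t
  refine ⟨r, hr, ?_⟩
  rw [decompose_add, DirectSum.add_apply, AddSubgroup.coe_add, e, add_sub_cancel_right]
  exact hN t hn

include 𝒜 in
lemma isHomogeneous_sup_span {N : Submodule R M} (hN : N.IsHomogeneous ℳ) {g : G} {m : M}
    (hm : m ∈ ℳ g) : (N ⊔ R ∙ m).IsHomogeneous ℳ := by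
  intro t y hy
  obtain ⟨r, -, h⟩ := exists_decompose_sub_mem (𝒜 := 𝒜) hN hm hy t
  rw [← sub_add_cancel (decompose ℳ y t : M) (r • m)]
  exact Submodule.add_mem_sup h (Submodule.smul_mem _ _ (Submodule.mem_span_singleton_self m))

variable [IsNoetherianRing R]

omit [GradedRing 𝒜] in
/-- Among the homogeneous elements outside a proper homogeneous submodule `N` there is one, `m`,
whose annihilator modulo `N` is maximal: a homogeneous multiple `x • m ∉ N` has no larger
annihilator. -/
lemma exists_homogeneous_maximal_annihilator {N : Submodule R M} (hN : N.IsHomogeneous ℳ)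
    (hne : N ≠ ⊤) :
    ∃ (g : G) (m : M), m ∈ ℳ g ∧ m ∉ N ∧
      ∀ (v : G) (x : R), x ∈ 𝒜 v → x • m ∉ N → ∀ r : R, r • x • m ∈ N → r • m ∈ N := by
  let ann : M → Ideal R := fun m => N.comap (LinearMap.toSpanSingleton R M m)
  have hann : ∀ m r, r ∈ ann m ↔ r • m ∈ N := fun m r => by simp [ann]
  let S : Set (Ideal R) := {I | ∃ (g : G) (m : M), m ∈ ℳ g ∧ m ∉ N ∧ ann m = I}
  have hS : S.Nonempty := by
    obtain ⟨y, hy⟩ : ∃ y, y ∉ N := by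
      by_contra! h
      exact hne (Submodule.eq_top_iff'.2 h)
    rw [Submodule.IsHomogeneous.mem_iff ℳ hN, not_forall] at hy
    obtain ⟨g, hg⟩ := hy
    exact ⟨_, g, _, (decompose ℳ y g).2, hg, rfl⟩
  obtain ⟨_, ⟨g, m, hm, hmN, rfl⟩, hmax⟩ := (wellFounded_gt (α := Ideal R)).has_min S hS
  refine ⟨g, m, hm, hmN, fun v x hx hxm r hr => ?_⟩
  have hle : ann m ≤ ann (x • m) := fun s hs => by
    rw [hann] at hs ⊢
    rw [smul_comm]
    exact N.smul_mem x hs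
  have heq : ann m = ann (x • m) := by
    by_contra h
    exact hmax _ ⟨v + g, x • m, SetLike.GradedSMul.smul_mem hx hm, hxm, rfl⟩ (lt_of_le_of_ne hle h)
  rwa [← hann, heq, hann]

variable {𝒜 ℳ} in
/-- Noetherian induction: the Hilbert series of `M / N` is rational for every homogeneous `N`. -/
theorem isRational_hilbertFun_top_sub [Module.Finite R M] (hM : IsModest 𝒜 ℳ)
    (N : Submodule R M) (hN : N.IsHomogeneous ℳ) :
    IsRational G (hilbertFun 𝒜 ℳ ⊤ - hilbertFun 𝒜 ℳ N) := by
  induction N using WellFoundedGT.induction with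
  | ind N ih =>
  by_cases hne : N = ⊤
  · subst hne
    rw [sub_self]
    exact (isRatLaurent_iff.2 (by simp)).isRational
  obtain ⟨g, m, hm, hmN, hmax⟩ := exists_homogeneous_maximal_annihilator 𝒜 ℳ hN hne
  have hlt : ∀ y, y ∉ N → N < N ⊔ R ∙ y := fun y hy =>
    lt_of_le_of_ne le_sup_left fun h => hy <| by
      rw [h]
      exact Submodule.mem_sup_right (Submodule.mem_span_singleton_self y)
  have h' := ih _ (hlt m hmN) (isHomogeneous_sup_span 𝒜 ℳ hN hm)
  suffices h : IsRational G (hilbertFun 𝒜 ℳ (N ⊔ R ∙ m) - hilbertFun 𝒜 ℳ N) by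
    simpa using h'.add h
  by_cases hx : ∃ (v : G) (x : R), v ≠ 0 ∧ x ∈ 𝒜 v ∧ x • m ∉ N
  · obtain ⟨v, x, hv, hx, hxm⟩ := hx
    have hxmdeg : x • m ∈ ℳ (v + g) := SetLike.GradedSMul.smul_mem hx hm
    have h'' := ih _ (hlt _ hxm) (isHomogeneous_sup_span 𝒜 ℳ hN hxmdeg)
    refine IsRational.of_polyMul v.2 (by simpa using hv) ?_
    convert h''.add h'.neg using 1
    ext t
    have hshift := hilbertFun_sub_shift hM (N := N) (N' := N ⊔ R ∙ m) (N'' := N ⊔ R ∙ (x • m))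
      le_sup_left le_sup_left hx
      (fun y hy => by
        obtain ⟨n, hn, z, hz, rfl⟩ := Submodule.mem_sup.1 hy
        obtain ⟨r, rfl⟩ := Submodule.mem_span_singleton.1 hz
        rw [smul_add, smul_comm x r m]
        exact Submodule.add_mem_sup (N.smul_mem x hn)
          (Submodule.smul_mem _ _ (Submodule.mem_span_singleton_self _)))
      (fun y hy => by
        refine ⟨fun h => ?_, fun h => N.smul_mem x h⟩
        obtain ⟨n, hn, z, hz, rfl⟩ := Submodule.mem_sup.1 hy
        obtain ⟨r, rfl⟩ := Submodule.mem_span_singleton.1 hz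
        refine N.add_mem hn (hmax v x hx hxm r ?_)
        rw [smul_add, N.add_mem_iff_right (N.smul_mem x hn), smul_comm x r m] at h
        exact h)
      (fun k z hz hzk => by
        obtain ⟨r, hr, hzr⟩ := exists_decompose_sub_mem (𝒜 := 𝒜) hN hxmdeg hz (v + k)
        rw [decompose_of_mem_same ℳ hzk] at hzr
        refine ⟨r • m, Submodule.mem_sup_right
          (Submodule.smul_mem _ _ (Submodule.mem_span_singleton_self m)), ?_, ?_⟩
        · have := SetLike.GradedSMul.smul_mem (A := 𝒜) (B := ℳ) hr hm
          rwa [vadd_eq_add, show v + k - (v + g) + g = k by abel] at this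
        · rwa [smul_comm])
      t
    rw [polyMul_one_sub_single]
    simp only [Pi.sub_apply, Pi.add_apply, Pi.neg_apply]
    rw [hshift]
    ring
  · push Not at hx
    refine (isRatLaurent_iff.2 ((Set.finite_singleton (g : Fin d → ℚ)).subset fun t ht => ?_))
      |>.isRational
    by_contra htg
    refine ht ?_
    by_cases htG : t ∈ G
    swap
    · simp [hilbertFun, htG]
    have hcomp : subComponent 𝒜 ℳ (N ⊔ R ∙ m) ⟨t, htG⟩ = subComponent 𝒜 ℳ N ⟨t, htG⟩ := by
      refine le_antisymm (fun y hy => ⟨hy.1, ?_⟩) (subComponent_mono 𝒜 ℳ le_sup_left _)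
      obtain ⟨r, hr, h⟩ := exists_decompose_sub_mem (𝒜 := 𝒜) hN hm hy.2 ⟨t, htG⟩
      rw [decompose_of_mem_same ℳ hy.1] at h
      have hrm : r • m ∈ N := hx _ r (fun h0 => htg (congrArg Subtype.val (sub_eq_zero.1 h0) : t = g)) hr
      exact (N.sub_mem_iff_left hrm).1 h
    rw [Pi.sub_apply, hilbertFun, hilbertFun, dif_pos htG, dif_pos htG, hcomp, sub_self]

end Graded

end GradedHilbert

end

theorem theorem7p10 {d : ℕ} (G : AddSubgroup (Fin d → ℚ))
    {R : Type*} [CommRing R] [IsNoetherianRing R]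
    (𝒜 : G → AddSubgroup R) [GradedRing 𝒜]
    {M : Type*} [AddCommGroup M] [Module R M] [Module.Finite R M]
    (ℳ : G → AddSubgroup M) [DirectSum.Decomposition ℳ] [SetLike.GradedSMul 𝒜 ℳ]
    (hM : GradedHilbert.IsModest 𝒜 ℳ) :
    (∃ (s : ℕ) (v : Fin s → (Fin d → ℚ)), (∀ i, v i ∈ G ∧ v i ≠ 0) ∧
      GradedHilbert.IsRatLaurent
        (GradedHilbert.polyMul (∏ i, (1 - AddMonoidAlgebra.single (v i) 1))
          (GradedHilbert.hilbertSeries 𝒜 ℳ))) ∧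
    GradedHilbert.IsSummable (GradedHilbert.hilbertSeries 𝒜 ℳ) := by
  have h : GradedHilbert.IsRational G (GradedHilbert.hilbertSeries 𝒜 ℳ) := by
    have hbot : (⊥ : Submodule R M).IsHomogeneous ℳ := fun i x hx => by
      simp [(Submodule.mem_bot R).1 hx]
    simpa [GradedHilbert.hilbertFun_bot, GradedHilbert.hilbertFun_top] using
      GradedHilbert.isRational_hilbertFun_top_sub hM ⊥ hbot
  refine ⟨?_, h.isSummable⟩
  obtain ⟨l, hl, h⟩ := h
  refine ⟨l.length, l.get, fun i => hl _ (l.get_mem i), ?_⟩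
  rwa [← List.prod_ofFn, ← Function.comp_def (fun v => 1 - AddMonoidAlgebra.single v 1) l.get,
    ← List.map_ofFn, List.ofFn_get]
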